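/- Data are transmitted over a block Rayleigh fading channel with bandwidth $W>0$, block length $T_B>0$ and average received SNR $\rho>0$, in the low SNR regime; that is, the amounts of service $s_0,s_1,s_2,\dots$ that the channel offers in successive blocks are independent and exponentially distributed with mean $\nu=WT_B\rho$. Data come in packets of size $L_p>0$, and exactly one packet arrives per block, packet $n$ just before the start of block $n$. Packets are transmitted one at a time, first come first served; when a packet is completed within a block, the rest of the service of that block is used for the next packets, and it is lost when no packet is left. The buffer has finite size $K\in\{0,1,2,\dots\}$, which means that at most $K$ packets can wait behind the packet in transmission: a packet that arrives while the transmitter is idle goes straight into transmission, a packet that arrives while a packet is in transmission and fewer than $K$ packets are waiting joins the queue, and a packet that arrives while a packet is in transmission and $K$ packets are waiting is rejected (overflow). At the start, at most $K$ packets are waiting and the packet in transmission, if any, has an arbitrary untransmitted part in $(0,L_p]$; if none is in transmission, none is waiting. The overflow probability $P_{\mathrm{overflow}}$ is the long-run fraction of packets that are rejected, i.e. the limit as $N\to\infty$ of the fraction of rejected packets among the first $N$ packets. **Theorem.** Let $\theta=\dfrac{L_p}{WT_B\rho}$ and assume $\theta<1$. Then the series $$\varphi_K=(1-\theta)\sum_{j=1}^{\infty}\frac{(j\theta)^{K+j}}{(K+j)!}\,e^{-j\theta}$$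 converges, and, for every such initial state, almost surely the limit $P_{\mathrm{overflow}}$ exists and equals $$P_{\mathrm{overflow}}=\frac{(1-\theta)\,\varphi_K}{1-\theta\,\varphi_K}.$$ -/

import Mathlib

open MeasureTheory ProbabilityTheory Filter Topology

namespace FadingQueue

/-- State of the transmitter at the end of a block. `residual` is the untransmitted amount of data of
the packet in transmission, and is `0` when the transmitter is idle. `waiting` is the number of
packets stored in the buffer behind the packet in transmission. -/
@[ext]
structure State where
  waiting : ℕ
  residual : ℝ

/-- The states that can occur for packet size `Lp` and buffer size `K`. -/
def State.Admissible (Lp : ℝ) (K : ℕ) (x : State) : Prop :=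
  x.waiting ≤ K ∧ 0 ≤ x.residual ∧ x.residual ≤ Lp ∧ (x.residual = 0 → x.waiting = 0)

/-- A packet that arrives in state `x` overflows: the transmitter is busy and the buffer is full. -/
def State.Overflow (K : ℕ) (x : State) : Prop :=
  x.residual ≠ 0 ∧ K ≤ x.waiting

open Classical in
/-- The state after the arrival of one packet of size `Lp`: it goes straight into transmission if the
transmitter is idle, is rejected if it overflows, and joins the end of the buffer otherwise. -/
noncomputable def State.arrive (Lp : ℝ) (K : ℕ) (x : State) : State :=
  if x.residual = 0 then ⟨x.waiting, Lp⟩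
  else if x.Overflow K then x
  else ⟨x.waiting + 1, x.residual⟩

open Classical in
/-- `serve Lp q r s` is the state reached when an amount `s` of channel service is used, first come
first served, with a packet in transmission of which `r` is left and `q` packets of size `Lp` waiting.
Service left over when a packet is completed goes to the next one, and is lost if there is none. -/
noncomputable def serve (Lp : ℝ) : ℕ → ℝ → ℝ → State
  | 0, r, s => if s < r then ⟨0, r - s⟩ else ⟨0, 0⟩
  | q + 1, r, s => if s < r then ⟨q + 1, r - s⟩ else serve Lp q Lp (s - r)

/-- The state found by packet `n` on arrival, when the initial state is `x₀` and block `n` offers the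
service `s n`. One packet arrives in each block: packet `n` arrives just before block `n` starts. -/
noncomputable def queue (Lp : ℝ) (K : ℕ) (x₀ : State) (s : ℕ → ℝ) : ℕ → State
  | 0 => x₀
  | n + 1 =>
    let y := (queue Lp K x₀ s n).arrive Lp K
    serve Lp y.waiting y.residual (s n)

open Classical in
/-- The fraction of rejected packets among the first `N` packets. -/
noncomputable def overflowFraction (Lp : ℝ) (K : ℕ) (x₀ : State) (s : ℕ → ℝ) (N : ℕ) : ℝ :=
  (((Finset.range N).filter fun n => (queue Lp K x₀ s n).Overflow K).card : ℝ) / N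

/-- The `j`-th term, `j ≥ 1`, of the series for `φ_K`. -/
noncomputable def phiTerm (θ : ℝ) (K j : ℕ) : ℝ :=
  (j * θ) ^ (K + j) * Real.exp (-(j * θ)) / (K + j).factorial

/-- `φ_K = (1 - θ) ∑_{j ≥ 1} (jθ)^(K+j) e^(-jθ) / (K+j)!`. -/
noncomputable def phi (θ : ℝ) (K : ℕ) : ℝ :=
  (1 - θ) * ∑' i : ℕ, phiTerm θ K (i + 1)

end FadingQueue

/-!
Measure time by the amount of service offered: blocks end at the points of a Poisson process of
rate `lam = 1 / (W * TB * ρ)`, so the queue is an M/D/1 queue of load `θ = lam * Lp` with `K`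
waiting places. Its overflow probability is found by solving the Poisson equation of the chain of
states seen by arriving packets.

With `p` the claimed probability (`overflowProb`), there is an explicit bounded function `V`
(`valueBefore`) such that `1_overflow - p = V - E[V (next state)]`: `valueBefore_eq` treats the
arrival and `hasExpMean_valueBefore_serve` the service, by induction on the number of waiting
packets and the memoryless property. Hence the number of overflows among the first `N` packets is
`N * p` plus a bounded term plus a sum of `N` bounded orthogonal variables, and the last is `o(N)`
almost surely (`ae_tendsto_sum_div_of_recursion`). This needs neither stationarity nor a
regeneration structure, and it applies to every admissible initial state.

The function `V` is built from `scaleFun`, which solves `U_k' = U_{k-1} - U_k` together with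
`U_{k+1}(θ) = 1 + U_k(0)`. These two relations account for all packet completions except the one
that leaves the transmitter idle; that one imposes the condition `valueCoeff_mul_scaleFun`, which
for `K ≥ 1` amounts to `1 - φ_K = (1 - θ) (U_K(0) - U_{K-1}(0))`, with a finite sum on the right.
That this agrees with the definition of `φ_K` by a series is Jensen's identity
`∑_{n ≥ 0} ((n - x) θ)^n e^{-(n - x) θ} / n! = 1 / (1 - θ)` at `x = K` (`hasSum_jensen`). The
denominator `1 - θ φ_K` is positive because `φ_K` decreases in `K` and `φ_0 = θ`.
-/

namespace FadingQueue

/-! ### A series identity of Jensen -/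

lemma abs_sub_pow_div_factorial_le (x : ℝ) (n : ℕ) :
    |((n : ℝ) - x) ^ n / (n.factorial : ℝ)| ≤ Real.exp |x| * Real.exp 1 ^ n := by
  have h1 : |(n : ℝ) - x| ≤ n + |x| := by
    simpa using abs_sub (n : ℝ) x
  rw [abs_div, abs_pow, Nat.abs_cast]
  calc |(n : ℝ) - x| ^ n / (n.factorial : ℝ) ≤ (n + |x|) ^ n / (n.factorial : ℝ) := by gcongr
    _ ≤ Real.exp (n + |x|) := Real.pow_div_factorial_le_exp _ (by positivity) n
    _ = Real.exp |x| * Real.exp 1 ^ n := by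
      rw [← Real.exp_nat_mul, ← Real.exp_add]; ring_nf

lemma mul_exp_neg_mul_exp_one_lt_one {θ : ℝ} (h : θ < 1) :
    θ * Real.exp (-θ) * Real.exp 1 < 1 := by
  have h1 : θ < Real.exp (θ - 1) := by
    have := Real.add_one_lt_exp (x := θ - 1) (by linarith)
    linarith
  have h2 : Real.exp (-θ) * Real.exp 1 * Real.exp (θ - 1) = 1 := by
    rw [← Real.exp_add, ← Real.exp_add]; simp
  calc θ * Real.exp (-θ) * Real.exp 1 = Real.exp (-θ) * Real.exp 1 * θ := by ring
    _ < Real.exp (-θ) * Real.exp 1 * Real.exp (θ - 1) := by gcongr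
    _ = 1 := h2

/-- The terms of Jensen's series, as a power series in `θ * exp (-θ)`. -/
lemma jensen_term_eq (x θ : ℝ) (n : ℕ) :
    ((n - x) * θ) ^ n * Real.exp (-((n - x) * θ)) / (n.factorial : ℝ)
      = Real.exp (x * θ) * ((n - x) ^ n / (n.factorial : ℝ) * (θ * Real.exp (-θ)) ^ n) := by
  have : Real.exp (-((n - x) * θ)) = Real.exp (x * θ) * Real.exp (-θ) ^ n := by
    rw [← Real.exp_nat_mul, ← Real.exp_add]; ring_nf
  rw [this, mul_pow, mul_pow]; ring

lemma summable_jensen_coeff (x w : ℝ) (hw : |w| * Real.exp 1 < 1) :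
    Summable fun n : ℕ => ((n : ℝ) - x) ^ n / (n.factorial : ℝ) * w ^ n := by
  refine Summable.of_norm_bounded
    (g := fun n : ℕ => Real.exp |x| * (|w| * Real.exp 1) ^ n)
    ((summable_geometric_of_lt_one (by positivity) hw).mul_left _) fun n => ?_
  rw [Real.norm_eq_abs, abs_mul, abs_pow, mul_pow, ← mul_assoc, mul_right_comm]
  exact mul_le_mul_of_nonneg_right (abs_sub_pow_div_factorial_le x n) (by positivity)

lemma summable_jensen (x : ℝ) {θ : ℝ} (h0 : 0 ≤ θ) (h1 : θ < 1) :
    Summable fun n : ℕ =>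
      (((n : ℝ) - x) * θ) ^ n * Real.exp (-((n - x) * θ)) / (n.factorial : ℝ) := by
  simp only [jensen_term_eq]
  refine (summable_jensen_coeff x _ ?_).mul_left _
  rw [abs_of_nonneg (by positivity)]
  exact mul_exp_neg_mul_exp_one_lt_one h1

/-- The `N`-th finite difference of `t ↦ t ^ N` is `N!`. -/
lemma sum_antidiagonal_sub_pow (x : ℝ) (N : ℕ) :
    ∑ q ∈ Finset.HasAntidiagonal.antidiagonal N,
      ((q.1 : ℝ) - x) ^ q.1 / (q.1.factorial : ℝ) * ((-((q.1 : ℝ) - x)) ^ q.2 / (q.2.factorial : ℝ))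
      = 1 := by
  have h := congrFun (fwdDiff_iter_eq_factorial (R := ℝ) (n := N)) (-x)
  rw [fwdDiff_iter_eq_sum_shift] at h
  rw [Finset.Nat.sum_antidiagonal_eq_sum_range_succ_mk]
  have hN : (N.factorial : ℝ) ≠ 0 := by positivity
  have h' : ∀ k ∈ Finset.range (N + 1),
      ((k : ℝ) - x) ^ k / (k.factorial : ℝ) *
        ((-((k : ℝ) - x)) ^ (N - k) / ((N - k).factorial : ℝ))
      = (((-1 : ℤ) ^ (N - k) * N.choose k) • (-x + k • (1 : ℝ)) ^ N) / N.factorial := by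
    intro k hk
    have hk' : k ≤ N := by simpa [Nat.lt_succ_iff] using hk
    rw [zsmul_eq_mul, nsmul_eq_mul, mul_one, neg_add_eq_sub, neg_pow ((k : ℝ) - x)]
    push_cast
    rw [Nat.cast_choose ℝ hk']
    have h3 : ((k : ℝ) - x) ^ N = ((k : ℝ) - x) ^ k * ((k : ℝ) - x) ^ (N - k) := by
      rw [← pow_add, Nat.add_sub_cancel' hk']
    rw [h3]
    field_simp
  simp only
  rw [Finset.sum_congr rfl h', ← Finset.sum_div, h]
  simp [hN]

/-- Jensen's identity for small `θ`: expanding the exponentials gives an absolutely convergent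
double series, whose sum over the terms of degree `N` in `θ` is `θ ^ N`. -/
lemma tsum_jensen_of_small (x : ℝ) {θ : ℝ} (h0 : 0 < θ) (h1 : θ < 1 / 8) :
    ∑' n : ℕ, (((n : ℝ) - x) * θ) ^ n * Real.exp (-((n - x) * θ)) / (n.factorial : ℝ)
      = (1 - θ)⁻¹ := by
  set f : ℕ × ℕ → ℝ := fun q => (((q.1 : ℝ) - x) * θ) ^ q.1 / (q.1.factorial : ℝ) *
    ((-(((q.1 : ℝ) - x) * θ)) ^ q.2 / (q.2.factorial : ℝ)) with hf
  have hexp : ∀ y : ℝ, HasSum (fun m : ℕ => y ^ m / (m.factorial : ℝ)) (Real.exp y) := fun y => by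
    rw [Real.exp_eq_exp_ℝ]; exact NormedSpace.expSeries_div_hasSum_exp y
  have habs : ∀ n : ℕ, HasSum (fun m : ℕ => ‖f (n, m)‖)
      (|((n : ℝ) - x) ^ n / (n.factorial : ℝ)| * θ ^ n * Real.exp (|(n : ℝ) - x| * θ)) := by
    intro n
    refine ((hexp (|(n : ℝ) - x| * θ)).mul_left
      (|((n : ℝ) - x) ^ n / (n.factorial : ℝ)| * θ ^ n)).congr_fun fun m => ?_
    simp only [hf, Real.norm_eq_abs, abs_mul, abs_div, abs_pow, abs_neg, Nat.abs_cast,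
      abs_of_pos h0, mul_pow]
    ring
  -- the bound `1 / 8` on `θ` is used here: `exp (1 + θ) < exp 2 < 8`
  have hr : Real.exp 1 * Real.exp θ * θ < 1 := by
    have h2 : Real.exp 1 * Real.exp θ ≤ Real.exp 1 * Real.exp 1 := by
      gcongr; linarith
    have h3 := Real.exp_one_lt_d9
    have h4 := Real.exp_pos 1
    nlinarith
  have hsum : Summable f := by
    refine Summable.of_norm ((summable_prod_of_nonneg fun q => norm_nonneg _).2
      ⟨fun n => (habs n).summable, ?_⟩)
    refine Summable.congr ?_ fun n => ((habs n).tsum_eq).symm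
    refine Summable.of_nonneg_of_le (fun n => by positivity) (fun n => ?_)
      ((summable_geometric_of_lt_one (by positivity) hr).mul_left
        (Real.exp |x| * Real.exp (|x| * θ)))
    have h2 : Real.exp (|(n : ℝ) - x| * θ) ≤ Real.exp (|x| * θ) * Real.exp θ ^ n := by
      rw [← Real.exp_nat_mul, ← Real.exp_add]
      gcongr
      have : |(n : ℝ) - x| ≤ n + |x| := by simpa using abs_sub (n : ℝ) x
      nlinarith
    calc _ ≤ (Real.exp |x| * Real.exp 1 ^ n) * θ ^ n * (Real.exp (|x| * θ) * Real.exp θ ^ n) := by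
          gcongr; exact abs_sub_pow_div_factorial_le x n
      _ = _ := by rw [mul_pow, mul_pow]; ring
  have e1 : ∑' q, f q
      = ∑' n : ℕ, (((n : ℝ) - x) * θ) ^ n * Real.exp (-((n - x) * θ)) / (n.factorial : ℝ) := by
    rw [hsum.tsum_prod]
    refine tsum_congr fun n => ?_
    simp only [hf, tsum_mul_left, (hexp _).tsum_eq]
    ring
  rw [← e1, ← tsum_geometric_of_lt_one h0.le (by linarith),
    ← Finset.HasAntidiagonal.sigmaAntidiagonalEquivProd.tsum_eq f]
  change ∑' c, (f ∘ Finset.HasAntidiagonal.sigmaAntidiagonalEquivProd) c = _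
  rw [Summable.tsum_sigma (Finset.HasAntidiagonal.sigmaAntidiagonalEquivProd.summable_iff.2 hsum)]
  refine tsum_congr fun N => ?_
  rw [tsum_fintype]
  simp only [Function.comp, Finset.HasAntidiagonal.sigmaAntidiagonalEquivProd_apply]
  rw [Finset.sum_coe_sort (Finset.HasAntidiagonal.antidiagonal N) f]
  rw [← mul_one (θ ^ N), ← sum_antidiagonal_sub_pow x N, Finset.mul_sum]
  refine Finset.sum_congr rfl fun q hq => ?_
  rw [← Finset.HasAntidiagonal.mem_antidiagonal.1 hq]
  simp only [hf, ← neg_mul, mul_pow, pow_add]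
  ring

/-- Jensen's identity. Up to the factor `exp (x * θ)` the left-hand side is a power series in
`θ * exp (-θ)`, so both sides are analytic on `(0, 1)`; they agree for small `θ`. -/
theorem hasSum_jensen (x : ℝ) {θ : ℝ} (h0 : 0 < θ) (h1 : θ < 1) :
    HasSum (fun n : ℕ =>
      (((n : ℝ) - x) * θ) ^ n * Real.exp (-((n - x) * θ)) / (n.factorial : ℝ)) (1 - θ)⁻¹ := by
  rw [(summable_jensen x h0.le h1).hasSum_iff]
  set c : ℕ → ℝ := fun n => ((n : ℝ) - x) ^ n / (n.factorial : ℝ) with hc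
  set P := FormalMultilinearSeries.ofScalars ℝ c with hP
  have hrad : ENNReal.ofReal (Real.exp (-1)) ≤ P.radius := by
    refine P.le_radius_of_bound (Real.exp |x|) (r := (Real.exp (-1)).toNNReal) fun n => ?_
    rw [hP, FormalMultilinearSeries.ofScalars_norm, Real.coe_toNNReal _ (Real.exp_pos _).le,
      Real.norm_eq_abs]
    calc _ ≤ Real.exp |x| * Real.exp 1 ^ n * Real.exp (-1) ^ n := by
          gcongr; exact abs_sub_pow_div_factorial_le x n
      _ = Real.exp |x| := by
        rw [mul_assoc, ← mul_pow, ← Real.exp_add]; simp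
  have hball : HasFPowerSeriesOnBall P.sum P 0 P.radius :=
    P.hasFPowerSeriesOnBall (lt_of_lt_of_le (by simp [Real.exp_pos]) hrad)
  have hseries : ∀ t : ℝ,
      ∑' n : ℕ, (((n : ℝ) - x) * t) ^ n * Real.exp (-((n - x) * t)) / (n.factorial : ℝ)
        = Real.exp (x * t) * P.sum (t * Real.exp (-t)) := by
    intro t
    simp only [jensen_term_eq, tsum_mul_left]
    congr 1
    refine tsum_congr fun n => ?_
    rw [hP, FormalMultilinearSeries.ofScalars_apply_eq]
    simp [hc]
  have hA : AnalyticOnNhd ℝ (fun t : ℝ => Real.exp (x * t) * P.sum (t * Real.exp (-t)))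
      (Set.Ioo 0 1) := by
    intro t ht
    have hmem : t * Real.exp (-t) ∈ Metric.eball (0 : ℝ) P.radius := by
      refine Metric.eball_subset_eball hrad ?_
      rw [Metric.eball_ofReal, mem_ball_zero_iff, Real.norm_eq_abs,
        abs_of_nonneg (mul_nonneg ht.1.le (Real.exp_pos _).le), Real.exp_neg 1,
        ← one_div, lt_div_iff₀ (Real.exp_pos 1)]
      exact mul_exp_neg_mul_exp_one_lt_one ht.2
    have h3 : AnalyticAt ℝ P.sum (t * Real.exp (-t)) := hball.analyticAt_of_mem hmem
    have h4 : AnalyticAt ℝ (fun t : ℝ => t * Real.exp (-t)) t := by fun_prop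
    have h5 : AnalyticAt ℝ (fun t : ℝ => Real.exp (x * t)) t := by fun_prop
    exact h5.mul (AnalyticAt.fun_comp h3 h4)
  have hB : AnalyticOnNhd ℝ (fun t : ℝ => (1 - t)⁻¹) (Set.Ioo 0 1) := by
    intro t ht
    exact AnalyticAt.inv (by fun_prop) (by linarith [ht.2])
  rw [hseries]
  refine hA.eqOn_of_preconnected_of_eventuallyEq hB isPreconnected_Ioo
    (z₀ := 1 / 16) (by constructor <;> norm_num) ?_ ⟨h0, h1⟩
  filter_upwards [Ioo_mem_nhds (show (0 : ℝ) < 1 / 16 by norm_num)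
    (show (1 / 16 : ℝ) < 1 / 8 by norm_num)] with t ht
  rw [← hseries, tsum_jensen_of_small x ht.1 ht.2]

/-! ### Solution of the functional equation of the queue -/

/-- The coefficient of `z ^ n` in `exp (x * (1 - z)) / (1 - z)`. -/
noncomputable def truncExp (n : ℕ) (x : ℝ) : ℝ :=
  Real.exp x * ∑ i ∈ Finset.range (n + 1), (-x) ^ i / (i.factorial : ℝ)

lemma truncExp_zero_left (x : ℝ) : truncExp 0 x = Real.exp x := by simp [truncExp]

lemma truncExp_succ (n : ℕ) (x : ℝ) :
    truncExp (n + 1) x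
      = truncExp n x + Real.exp x * ((-x) ^ (n + 1) / ((n + 1).factorial : ℝ)) := by
  rw [truncExp, Finset.sum_range_succ, mul_add, truncExp]

lemma truncExp_zero_right (n : ℕ) : truncExp n 0 = 1 := by
  simp [truncExp, Finset.sum_range_succ']

lemma hasDerivAt_truncExp (n : ℕ) (x : ℝ) :
    HasDerivAt (truncExp n) (Real.exp x * ((-x) ^ n / (n.factorial : ℝ))) x := by
  induction n with
  | zero =>
    simpa [funext truncExp_zero_left] using Real.hasDerivAt_exp x
  | succ n ih =>
    rw [funext (truncExp_succ n)]
    have h1 : HasDerivAt (fun y : ℝ => (-y) ^ (n + 1) / ((n + 1).factorial : ℝ))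
        (-((-x) ^ n / (n.factorial : ℝ))) x := by
      have h2 := ((hasDerivAt_neg x).pow (n + 1)).div_const ((n + 1).factorial : ℝ)
      refine h2.congr_deriv ?_
      rw [Nat.factorial_succ]
      push_cast
      field_simp
    exact (ih.add ((Real.hasDerivAt_exp x).mul h1)).congr_deriv (by ring)

/-- The coefficient of `z ^ k` in `∑_{m ≥ 1} z ^ m exp ((m θ - t) (1 - z)) / (1 - z)`. With
`A(z) = exp (-θ (1 - z))`, the generating function of the number of arrivals during one packet
transmission, this series is `exp (-t (1 - z)) z / ((1 - z) (A(z) - z))`. -/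
noncomputable def scaleFun (θ : ℝ) (k : ℕ) (t : ℝ) : ℝ :=
  ∑ m ∈ Finset.range k, truncExp (k - 1 - m) ((m + 1) * θ - t)

lemma scaleFun_zero (θ t : ℝ) : scaleFun θ 0 t = 0 := by simp [scaleFun]

/-- The difference of consecutive scale functions, as a finite sum. -/
lemma scaleFun_succ_sub (θ : ℝ) (k : ℕ) (t : ℝ) :
    scaleFun θ (k + 1) t - scaleFun θ k t
      = ∑ m ∈ Finset.range (k + 1), Real.exp ((m + 1) * θ - t) *
          ((-((m + 1) * θ - t)) ^ (k - m) / ((k - m).factorial : ℝ)) := by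
  rw [scaleFun, scaleFun, Finset.sum_range_succ, Finset.sum_range_succ, add_sub_right_comm,
    ← Finset.sum_sub_distrib]
  congr 1
  · refine Finset.sum_congr rfl fun m hm => ?_
    have hm' := Finset.mem_range.1 hm
    obtain ⟨j, hj⟩ : ∃ j, k = m + 1 + j := ⟨k - (m + 1), by omega⟩
    have e1 : k + 1 - 1 - m = j + 1 := by omega
    have e2 : k - 1 - m = j := by omega
    have e3 : k - m = j + 1 := by omega
    rw [e1, e2, e3, truncExp_succ]
    ring
  · simp [truncExp_zero_left]

lemma hasDerivAt_scaleFun_succ (θ : ℝ) (k : ℕ) (t : ℝ) :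
    HasDerivAt (scaleFun θ (k + 1)) (scaleFun θ k t - scaleFun θ (k + 1) t) t := by
  have h : ∀ m ∈ Finset.range (k + 1), HasDerivAt
      (fun t => truncExp (k + 1 - 1 - m) ((m + 1) * θ - t))
      (-(Real.exp ((m + 1) * θ - t) *
          ((-((m + 1) * θ - t)) ^ (k - m) / ((k - m).factorial : ℝ)))) t := by
    intro m _
    have h1 : HasDerivAt (fun t : ℝ => (m + 1) * θ - t) (-1) t :=
      (hasDerivAt_id t).const_sub _
    exact ((hasDerivAt_truncExp (k + 1 - 1 - m) ((m + 1) * θ - t)).comp t h1).congr_deriv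
      (by simp)
  have h2 := HasDerivAt.fun_sum h
  rw [Finset.sum_neg_distrib, ← scaleFun_succ_sub, neg_sub] at h2
  exact h2

lemma hasDerivAt_scaleFun (θ : ℝ) (k : ℕ) (t : ℝ) :
    HasDerivAt (scaleFun θ k) (scaleFun θ (k - 1) t - scaleFun θ k t) t := by
  cases k with
  | zero =>
    rw [funext (scaleFun_zero θ)]
    simpa using hasDerivAt_const t (0 : ℝ)
  | succ k => exact hasDerivAt_scaleFun_succ θ k t

lemma continuous_scaleFun (θ : ℝ) (k : ℕ) : Continuous (scaleFun θ k) :=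
  continuous_iff_continuousAt.2 fun t => (hasDerivAt_scaleFun θ k t).continuousAt

/-- Starting a new packet shifts the scale function by one. -/
lemma scaleFun_succ_self (θ : ℝ) (k : ℕ) :
    scaleFun θ (k + 1) θ = 1 + scaleFun θ k 0 := by
  rw [scaleFun, Finset.sum_range_succ', scaleFun, add_comm]
  congr 1
  · simp [truncExp_zero_right]
  · refine Finset.sum_congr rfl fun m hm => ?_
    have e : k + 1 - 1 - (m + 1) = k - 1 - m := by omega
    rw [e]; congr 1; push_cast; ring

/-! ### The series `φ_K` -/

lemma phiTerm_nonneg {θ : ℝ} (h0 : 0 ≤ θ) (K j : ℕ) : 0 ≤ phiTerm θ K j := by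
  unfold phiTerm; positivity

lemma phiTerm_eq_jensen (θ : ℝ) (K i : ℕ) :
    phiTerm θ K (i + 1) = ((((i + (K + 1) : ℕ) : ℝ) - K) * θ) ^ (i + (K + 1)) *
      Real.exp (-((((i + (K + 1) : ℕ) : ℝ) - K) * θ)) / ((i + (K + 1)).factorial : ℝ) := by
  have e1 : K + (i + 1) = i + (K + 1) := by omega
  have e2 : (((i + (K + 1) : ℕ) : ℝ) - K) = ((i + 1 : ℕ) : ℝ) := by push_cast; ring
  rw [phiTerm, e1, e2]

lemma summable_phiTerm {θ : ℝ} (h0 : 0 < θ) (h1 : θ < 1) (K : ℕ) :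
    Summable fun i : ℕ => phiTerm θ K (i + 1) := by
  simp only [phiTerm_eq_jensen]
  exact (summable_nat_add_iff (K + 1)).2 (summable_jensen (K : ℝ) h0.le h1)

/-- Jensen's identity expresses `φ_K` by a finite sum. -/
lemma one_sub_phi_eq {θ : ℝ} (h0 : 0 < θ) (h1 : θ < 1) (K : ℕ) :
    1 - phi θ K = (1 - θ) * ∑ n ∈ Finset.range (K + 1), (((n : ℝ) - K) * θ) ^ n *
      Real.exp (-((n - K) * θ)) / (n.factorial : ℝ) := by
  have h := hasSum_jensen (K : ℝ) h0 h1
  have h2 := h.summable.sum_add_tsum_nat_add (K + 1)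
  rw [h.tsum_eq] at h2
  have h3 : phi θ K = (1 - θ) * ((1 - θ)⁻¹ - ∑ n ∈ Finset.range (K + 1), (((n : ℝ) - K) * θ) ^ n *
      Real.exp (-((n - K) * θ)) / (n.factorial : ℝ)) := by
    rw [phi, ← h2, add_sub_cancel_left]
    simp only [phiTerm_eq_jensen]
  rw [h3, mul_sub, mul_inv_cancel₀ (by linarith)]
  ring

/-- The finite sum for `1 - φ_K` is an increment of the scale function. -/
lemma one_sub_phi_eq_scaleFun {θ : ℝ} (h0 : 0 < θ) (h1 : θ < 1) (K : ℕ) :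
    1 - phi θ (K + 1) = (1 - θ) * (scaleFun θ (K + 1) 0 - scaleFun θ K 0) := by
  rw [one_sub_phi_eq h0 h1, scaleFun_succ_sub, Finset.sum_range_succ]
  rw [← Finset.sum_range_reflect (fun m : ℕ => _ * (_ / _))]
  congr 1
  rw [sub_self, zero_mul, zero_pow (by omega), zero_mul, zero_div, add_zero]
  refine Finset.sum_congr rfl fun n hn => ?_
  have hn' := Finset.mem_range.1 hn
  have e1 : K - (K + 1 - 1 - n) = n := by omega
  have e2 : ((K + 1 - 1 - n : ℕ) : ℝ) = K - n := by
    rw [Nat.add_sub_cancel, Nat.cast_sub (by omega)]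
  rw [e1, e2]
  push_cast
  have e3 : ((K : ℝ) - n + 1) * θ - 0 = -((n - (K + 1)) * θ) := by ring
  rw [e3, neg_neg]
  ring

lemma phi_zero {θ : ℝ} (h0 : 0 < θ) (h1 : θ < 1) : phi θ 0 = θ := by
  have := one_sub_phi_eq h0 h1 0
  simp at this
  linarith

lemma phi_succ_le {θ : ℝ} (h0 : 0 < θ) (h1 : θ < 1) (K : ℕ) : phi θ (K + 1) ≤ phi θ K := by
  refine mul_le_mul_of_nonneg_left ?_ (by linarith)
  refine (summable_phiTerm h0 h1 (K + 1)).tsum_le_tsum (fun i => ?_) (summable_phiTerm h0 h1 K)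
  have e : phiTerm θ (K + 1) (i + 1)
      = phiTerm θ K (i + 1) * (((i + 1 : ℕ) : ℝ) * θ / ((K + (i + 1) + 1 : ℕ) : ℝ)) := by
    have e1 : K + 1 + (i + 1) = K + (i + 1) + 1 := by omega
    rw [phiTerm, phiTerm, e1, Nat.factorial_succ, pow_succ]
    push_cast
    field_simp
  rw [e]
  refine mul_le_of_le_one_right (phiTerm_nonneg h0.le _ _) ?_
  rw [div_le_one (by positivity)]
  push_cast
  nlinarith [Nat.cast_nonneg (α := ℝ) i, Nat.cast_nonneg (α := ℝ) K]

lemma phi_le {θ : ℝ} (h0 : 0 < θ) (h1 : θ < 1) (K : ℕ) : phi θ K ≤ θ := by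
  induction K with
  | zero => exact (phi_zero h0 h1).le
  | succ K ih => exact (phi_succ_le h0 h1 K).trans ih

lemma one_sub_mul_phi_pos {θ : ℝ} (h0 : 0 < θ) (h1 : θ < 1) (K : ℕ) : 0 < 1 - θ * phi θ K := by
  nlinarith [phi_le h0 h1 K]

/-- The claimed overflow probability. -/
noncomputable def overflowProb (θ : ℝ) (K : ℕ) : ℝ :=
  (1 - θ) * phi θ K / (1 - θ * phi θ K)

/-- The constant by which the scale function enters the relative value function, chosen so that the
constant terms of the Poisson equation balance when a packet is completed. -/
noncomputable def valueCoeff (θ : ℝ) (K : ℕ) : ℝ := 1 - θ * (1 - overflowProb θ K)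

lemma valueCoeff_eq {θ : ℝ} (h0 : 0 < θ) (h1 : θ < 1) (K : ℕ) :
    valueCoeff θ K = (1 - θ) / (1 - θ * phi θ K) := by
  have := (one_sub_mul_phi_pos h0 h1 K).ne'
  rw [valueCoeff, overflowProb]
  field_simp
  ring

/-- The boundary condition of the Poisson equation: the relative value of the idle state is the
limit of that of a packet about to be completed with none waiting. -/
lemma valueCoeff_mul_scaleFun {θ : ℝ} (h0 : 0 < θ) (h1 : θ < 1) (K : ℕ) :
    valueCoeff θ K * (scaleFun θ K 0 - scaleFun θ K θ)
      = 1 - overflowProb θ K - valueCoeff θ K := by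
  have hp := (one_sub_mul_phi_pos h0 h1 K).ne'
  cases K with
  | zero =>
    rw [valueCoeff_eq h0 h1, overflowProb, scaleFun_zero, scaleFun_zero]
    field_simp
    rw [phi_zero h0 h1]
    ring
  | succ K =>
    have h2 := one_sub_phi_eq_scaleFun h0 h1 K
    have h3 : valueCoeff θ (K + 1) * (scaleFun θ (K + 1) 0 - scaleFun θ K 0)
        = (1 - phi θ (K + 1)) / (1 - θ * phi θ (K + 1)) := by
      rw [valueCoeff_eq h0 h1, h2]; ring
    rw [scaleFun_succ_self, ← sub_sub, sub_right_comm, mul_sub, h3, mul_one, overflowProb,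
      sub_left_inj, eq_sub_iff_add_eq, ← add_div, div_eq_one_iff_eq hp]
    ring

/-! ### The Poisson equation of the queue -/

/-- `v` is the mean of `g S` when `S` is exponential with rate `lam`, and this mean exists. -/
def HasExpMean (lam : ℝ) (g : ℝ → ℝ) (v : ℝ) : Prop :=
  IntegrableOn (fun s => lam * Real.exp (-(lam * s)) * g s) (Set.Ioi 0) ∧
    ∫ s in Set.Ioi 0, lam * Real.exp (-(lam * s)) * g s = v

lemma hasExpMean_const {lam : ℝ} (hlam : 0 < lam) (c : ℝ) : HasExpMean lam (fun _ => c) c := by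
  have h1 := integrableOn_exp_mul_Ioi (neg_lt_zero.2 hlam) 0
  have h2 := integral_exp_mul_Ioi (neg_lt_zero.2 hlam) 0
  have e : (fun s : ℝ => lam * Real.exp (-(lam * s)) * c)
      = fun s => lam * c * Real.exp (-lam * s) := by
    ext s; rw [neg_mul]; ring
  refine ⟨?_, ?_⟩
  · rw [e]; exact h1.const_mul _
  · rw [e, integral_const_mul, h2]
    simp
    field_simp

lemma HasExpMean.sub_const {lam v : ℝ} (hlam : 0 < lam) {g : ℝ → ℝ} (h : HasExpMean lam g v)
    (c : ℝ) : HasExpMean lam (fun s => g s - c) (v - c) := by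
  have hc := hasExpMean_const hlam c
  simp only [HasExpMean, mul_sub]
  exact ⟨h.1.sub hc.1, by rw [integral_sub h.1 hc.1, h.2, hc.2]⟩

/-- Conditioning on whether `S` exceeds `r`: by the memoryless property the excess `S - r` is again
exponential. On `(0, r)` the contribution is computed from a primitive `P`. -/
lemma HasExpMean.split {lam r v : ℝ} (hr : 0 < r) {g g' F P : ℝ → ℝ} (h : HasExpMean lam g' v)
    (hF : Continuous F) (hP : ∀ s, HasDerivAt P (lam * Real.exp (-(lam * s)) * F s) s)
    (hleft : ∀ s, s < r → g s = F s) (hright : ∀ s, r ≤ s → g s = g' (s - r)) :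
    HasExpMean lam g (P r - P 0 + Real.exp (-(lam * r)) * v) := by
  have hFc : Continuous fun s => lam * Real.exp (-(lam * s)) * F s := by fun_prop
  have ae_left : (fun s => lam * Real.exp (-(lam * s)) * F s)
      =ᵐ[volume.restrict (Set.Ioc 0 r)] fun s => lam * Real.exp (-(lam * s)) * g s := by
    rw [← restrict_Ioo_eq_restrict_Ioc]
    filter_upwards [ae_restrict_mem measurableSet_Ioo] with s hs
    rw [hleft s hs.2]
  have eq_right : Set.EqOn
      (fun s => Real.exp (-(lam * r)) * (lam * Real.exp (-(lam * (s - r))) * g' (s - r)))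
      (fun s => lam * Real.exp (-(lam * s)) * g s) (Set.Ioi r) := by
    intro s hs
    have e : Real.exp (-(lam * s)) = Real.exp (-(lam * r)) * Real.exp (-(lam * (s - r))) := by
      rw [← Real.exp_add]; ring_nf
    simp only
    rw [hright s (le_of_lt hs), e]; ring
  have mp := measurePreserving_sub_right (volume : Measure ℝ) r
  have me := (MeasurableEquiv.subRight r).measurableEmbedding
  have hpre : (fun s : ℝ => s - r) ⁻¹' Set.Ioi 0 = Set.Ioi r := by ext s; simp
  have int_left : IntegrableOn (fun s => lam * Real.exp (-(lam * s)) * g s) (Set.Ioc 0 r) :=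
    Integrable.congr (hFc.integrableOn_Ioc) ae_left
  have int_right : IntegrableOn (fun s => lam * Real.exp (-(lam * s)) * g s) (Set.Ioi r) := by
    have h1 := (mp.integrableOn_comp_preimage me).2 h.1
    rw [hpre] at h1
    exact (IntegrableOn.congr_fun (h1.const_mul (Real.exp (-(lam * r)))) eq_right measurableSet_Ioi)
  have val_left : ∫ s in Set.Ioc 0 r, lam * Real.exp (-(lam * s)) * g s = P r - P 0 := by
    rw [← integral_congr_ae ae_left, ← intervalIntegral.integral_of_le hr.le]
    exact intervalIntegral.integral_eq_sub_of_hasDerivAt (fun s _ => hP s)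
      (hFc.intervalIntegrable _ _)
  have val_right : ∫ s in Set.Ioi r, lam * Real.exp (-(lam * s)) * g s
      = Real.exp (-(lam * r)) * v := by
    rw [← setIntegral_congr_fun measurableSet_Ioi eq_right, integral_const_mul, ← h.2, ← hpre]
    congr 1
    exact mp.setIntegral_preimage_emb me
      (fun s => lam * Real.exp (-(lam * s)) * g' s) (Set.Ioi 0)
  rw [HasExpMean, ← Set.Ioc_union_Ioi_eq_Ioi hr.le]
  refine ⟨int_left.union int_right, ?_⟩
  rw [setIntegral_union (Set.Ioc_disjoint_Ioi le_rfl) measurableSet_Ioi int_left int_right,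
    val_left, val_right]

lemma HasExpMean.integral_expMeasure {lam v : ℝ} (hlam : 0 < lam) {g : ℝ → ℝ}
    (h : HasExpMean lam g v) : ∫ s, g s ∂(expMeasure lam) = v := by
  have hm : Measurable (exponentialPDF lam) :=
    (measurable_exponentialPDFReal lam).ennreal_ofReal
  change ∫ s, g s ∂(volume.withDensity (exponentialPDF lam)) = v
  rw [integral_withDensity_eq_integral_toReal_smul hm
    (Eventually.of_forall fun s => ENNReal.ofReal_lt_top), ← h.2,
    ← integral_indicator measurableSet_Ioi]
  refine integral_congr_ae ?_
  filter_upwards [compl_mem_ae_iff.2 (measure_singleton (0 : ℝ))] with s hs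
  have hs0 : s ≠ 0 := hs
  rw [exponentialPDF_eq, smul_eq_mul]
  rcases lt_or_gt_of_ne hs0 with hs1 | hs1
  · simp [not_le.2 hs1, not_lt.2 hs1.le]
  · rw [Set.indicator_of_mem (Set.mem_Ioi.2 hs1), if_pos hs1.le,
      ENNReal.toReal_ofReal (by positivity)]

/-- The relative value of the state `⟨q, r⟩`, `r > 0`, just after an arrival: up to a constant, the
expected number of future overflows in excess of those predicted by the overflow probability. -/
noncomputable def valueAfter (θ lam : ℝ) (K q : ℕ) (r : ℝ) : ℝ :=
  (1 - overflowProb θ K) * (lam * r) - (K - q) + valueCoeff θ K * scaleFun θ (K - q) (lam * r)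

open Classical in
/-- The relative value of a state found by an arriving packet. In the idle state the arriving packet
goes straight into transmission; its size `Lp` enters through `θ = lam * Lp`. -/
noncomputable def valueBefore (θ lam : ℝ) (K : ℕ) (x : State) : ℝ :=
  if x.residual = 0 then
    -overflowProb θ K + ((1 - overflowProb θ K) * θ - K + valueCoeff θ K * scaleFun θ K θ)
  else (1 - overflowProb θ K) * (1 + lam * x.residual) - (K - x.waiting)
    + valueCoeff θ K * scaleFun θ (K - x.waiting - 1) (lam * x.residual)

open Classical in
/-- The change of the relative value at an arrival. -/
lemma valueBefore_eq {θ lam Lp : ℝ} (hθ : lam * Lp = θ) {K : ℕ} {x : State}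
    (hx : x.Admissible Lp K) :
    valueBefore θ lam K x = (if x.Overflow K then 1 else 0) - overflowProb θ K
      + valueAfter θ lam K (x.arrive Lp K).waiting (x.arrive Lp K).residual := by
  obtain ⟨q, r⟩ := x
  obtain ⟨hq, -, -, h0⟩ := hx
  simp only at hq h0
  by_cases hr : r = 0
  · obtain rfl := h0 hr
    simp [valueBefore, State.arrive, State.Overflow, valueAfter, hr, hθ]
  · by_cases hqK : K ≤ q
    · obtain rfl : q = K := le_antisymm hq hqK
      simp [valueBefore, State.arrive, State.Overflow, valueAfter, hr]
      simp [scaleFun_zero]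
      ring
    · simp [valueBefore, State.arrive, State.Overflow, valueAfter, hr, hqK, Nat.sub_sub]
      ring

lemma hasDerivAt_valueAfter (θ lam : ℝ) (K q : ℕ) (r s : ℝ) :
    HasDerivAt (fun s => -(Real.exp (-(lam * s)) * valueAfter θ lam K q (r - s)))
      (lam * Real.exp (-(lam * s)) * ((1 - overflowProb θ K) * (1 + lam * (r - s)) - (K - q)
        + valueCoeff θ K * scaleFun θ (K - q - 1) (lam * (r - s)))) s := by
  have h1 : HasDerivAt (fun s : ℝ => lam * (r - s)) (-lam) s := by
    simpa using ((hasDerivAt_id s).const_sub r).const_mul lam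
  have h2 : HasDerivAt (fun s : ℝ => scaleFun θ (K - q) (lam * (r - s)))
      ((scaleFun θ (K - q - 1) (lam * (r - s)) - scaleFun θ (K - q) (lam * (r - s))) * -lam) s :=
    HasDerivAt.comp (h₂ := scaleFun θ (K - q)) s (hasDerivAt_scaleFun θ (K - q) (lam * (r - s))) h1
  have h3 : HasDerivAt (fun s => Real.exp (-(lam * s))) (Real.exp (-(lam * s)) * -lam) s := by
    have h4 : HasDerivAt (fun s : ℝ => -(lam * s)) (-lam) s := by
      simpa [neg_mul] using (hasDerivAt_id s).const_mul (-lam)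
    exact h4.exp
  have h5 : HasDerivAt (fun s => valueAfter θ lam K q (r - s)) _ s :=
    (((h1.const_mul (1 - overflowProb θ K)).sub_const ((K : ℝ) - q)).add
      (h2.const_mul (valueCoeff θ K)))
  refine (h3.mul h5).neg.congr_deriv ?_
  simp only [valueAfter]
  ring

/-- The relative value after an arrival is the mean relative value one block later. -/
lemma hasExpMean_valueBefore_serve {θ lam Lp : ℝ} (h0 : 0 < θ) (h1 : θ < 1) (hlam : 0 < lam)
    (hLp : 0 < Lp) (hθ : lam * Lp = θ) {K q : ℕ} (hq : q ≤ K) {r : ℝ} (hr : 0 < r) :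
    HasExpMean lam (fun s => valueBefore θ lam K (serve Lp q r s)) (valueAfter θ lam K q r) := by
  -- the induction step: `v` is the mean from the completion of the packet in transmission onwards
  have key : ∀ (q : ℕ) (r v : ℝ) (g g' : ℝ → ℝ), 0 < r → HasExpMean lam g' v →
      (∀ s, s < r → g s = valueBefore θ lam K ⟨q, r - s⟩) →
      (∀ s, r ≤ s → g s = g' (s - r)) → valueAfter θ lam K q 0 = v →
      HasExpMean lam g (valueAfter θ lam K q r) := by
    intro q r v g g' hr hg' hleft hright hv
    have hsF : Continuous (scaleFun θ (K - q - 1)) := continuous_scaleFun _ _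
    have := hg'.split hr (g := g) (by fun_prop)
      (hasDerivAt_valueAfter θ lam K q r) (fun s hs => ?_) hright
    · convert this using 1
      simp [hv]
    · rw [hleft s hs, valueBefore, if_neg (by simpa using (sub_pos.2 hs).ne')]
  induction q generalizing r with
  | zero =>
    refine key 0 r _ _ _ hr (hasExpMean_const hlam (valueBefore θ lam K ⟨0, 0⟩))
      (fun s hs => by simp [serve, hs]) (fun s hs => by simp [serve, not_lt.2 hs]) ?_
    have := valueCoeff_mul_scaleFun h0 h1 K
    simp only [valueAfter, valueBefore, if_true, Nat.sub_zero, mul_zero, Nat.cast_zero]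
    have hc : valueCoeff θ K = 1 - θ * (1 - overflowProb θ K) := rfl
    linarith
  | succ q ih =>
    refine key (q + 1) r _ _ _ hr (ih (by omega) hLp)
      (fun s hs => by simp [serve, hs]) (fun s hs => by simp [serve, not_lt.2 hs]) ?_
    have e : K - q = K - (q + 1) + 1 := by omega
    rw [valueAfter, valueAfter, hθ, e, mul_zero, scaleFun_succ_self]
    have hc : valueCoeff θ K = 1 - θ * (1 - overflowProb θ K) := rfl
    push_cast
    linarith

lemma exists_abs_valueBefore_le (θ lam Lp : ℝ) (K : ℕ) :
    ∃ C, ∀ x : State, x.Admissible Lp K → |valueBefore θ lam K x| ≤ C := by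
  have h : ∀ q : ℕ, ∃ C, ∀ r ∈ Set.Icc 0 Lp, ‖(1 - overflowProb θ K) * (1 + lam * r) - (K - q)
      + valueCoeff θ K * scaleFun θ (K - q - 1) (lam * r)‖ ≤ C := by
    intro q
    refine isCompact_Icc.exists_bound_of_continuousOn (Continuous.continuousOn ?_)
    have hsF : Continuous (scaleFun θ (K - q - 1)) := continuous_scaleFun _ _
    fun_prop
  choose C hC using h
  have hC0 : ∀ q r, r ∈ Set.Icc 0 Lp → 0 ≤ C q := fun q r hr => (norm_nonneg _).trans (hC q r hr)
  refine ⟨|-overflowProb θ K +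
    ((1 - overflowProb θ K) * θ - K + valueCoeff θ K * scaleFun θ K θ)|
    + ∑ q ∈ Finset.range (K + 1), C q, fun x hx => ?_⟩
  have hr : x.residual ∈ Set.Icc 0 Lp := ⟨hx.2.1, hx.2.2.1⟩
  have hsum : C x.waiting ≤ ∑ q ∈ Finset.range (K + 1), C q :=
    Finset.single_le_sum (fun q _ => hC0 q _ hr) (Finset.mem_range.2 (Nat.lt_succ_of_le hx.1))
  unfold valueBefore
  split_ifs
  · linarith [hC0 x.waiting _ hr]
  · exact ((hC x.waiting _ hr).trans hsum).trans (le_add_of_nonneg_left (abs_nonneg _))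

/-! ### A strong law for bounded orthogonal variables -/

section StrongLaw

variable {Ω : Type*} [MeasurableSpace Ω] {μ : Measure Ω}

/-- If the averages of a bounded sequence vanish along the squares, they vanish. -/
lemma tendsto_sum_div_of_squares {d : ℕ → ℝ} {C : ℝ} (hC : ∀ n, |d n| ≤ C)
    (h : Tendsto (fun k : ℕ => (∑ i ∈ Finset.range (k ^ 2), d i) / (k ^ 2 : ℝ)) atTop (𝓝 0)) :
    Tendsto (fun N : ℕ => (∑ i ∈ Finset.range N, d i) / N) atTop (𝓝 0) := by
  have hC0 : 0 ≤ C := (abs_nonneg _).trans (hC 0)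
  have hsqrt : Tendsto Nat.sqrt atTop atTop :=
    tendsto_atTop.2 fun b => by
      filter_upwards [eventually_ge_atTop (b * b)] with N hN using Nat.le_sqrt.2 hN
  have h1 := (tendsto_zero_iff_abs_tendsto_zero _).1 h
  have h2 : Tendsto (fun k : ℕ => 2 * C / (k : ℝ)) atTop (𝓝 0) :=
    tendsto_const_div_atTop_nhds_zero_nat _
  have h3 := (h1.add h2).comp hsqrt
  rw [add_zero] at h3
  refine squeeze_zero_norm' ?_ h3
  filter_upwards [eventually_ge_atTop 1] with N hN
  -- `N` exceeds the largest square `k ^ 2 ≤ N` by at most `2 * k`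
  set k := Nat.sqrt N with hk
  have hk1 : 1 ≤ k := Nat.le_sqrt.2 (by omega)
  have hkN : k ^ 2 ≤ N := Nat.sqrt_le' N
  have hNk : N ≤ k ^ 2 + 2 * k := by
    have := Nat.sqrt_le_add N
    nlinarith
  have hkR : (0 : ℝ) < k := by exact_mod_cast hk1
  have hkN' : (k : ℝ) ^ 2 ≤ N := by exact_mod_cast hkN
  have hNk' : (N : ℝ) ≤ k ^ 2 + 2 * k := by exact_mod_cast hNk
  have hsplit : |∑ i ∈ Finset.range N, d i|
      ≤ |∑ i ∈ Finset.range (k ^ 2), d i| + 2 * C * k := by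
    rw [← Finset.sum_range_add_sum_Ico d hkN]
    refine (abs_add_le _ _).trans (add_le_add le_rfl ?_)
    calc |∑ i ∈ Finset.Ico (k ^ 2) N, d i| ≤ ∑ i ∈ Finset.Ico (k ^ 2) N, C :=
          (Finset.abs_sum_le_sum_abs _ _).trans (Finset.sum_le_sum fun i _ => hC i)
      _ = ((N : ℝ) - k ^ 2) * C := by
          rw [Finset.sum_const, Nat.card_Ico, nsmul_eq_mul, Nat.cast_sub hkN]; push_cast; ring
      _ ≤ 2 * C * k := by nlinarith
  rw [Real.norm_eq_abs, abs_div, Nat.abs_cast]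
  simp only [Function.comp, ← hk]
  rw [abs_div, abs_of_pos (by positivity : (0 : ℝ) < (k : ℝ) ^ 2)]
  calc _ ≤ (|∑ i ∈ Finset.range (k ^ 2), d i| + 2 * C * k) / (k : ℝ) ^ 2 := by
        gcongr
    _ = _ := by field_simp

lemma integral_sum_sq_le [IsProbabilityMeasure μ] {D : ℕ → Ω → ℝ} (hD : ∀ n, Measurable (D n))
    {C : ℝ} (hC : ∀ n ω, |D n ω| ≤ C) (horth : ∀ m n, m < n → ∫ ω, D m ω * D n ω ∂μ = 0) (N : ℕ) :
    ∫ ω, (∑ i ∈ Finset.range N, D i ω) ^ 2 ∂μ ≤ C ^ 2 * N := by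
  have hint : ∀ m n, Integrable (fun ω => D m ω * D n ω) μ := fun m n =>
    Integrable.of_bound ((hD m).mul (hD n)).aestronglyMeasurable (C * C)
      (Eventually.of_forall fun ω => by
        rw [norm_mul]
        exact mul_le_mul (hC m ω) (hC n ω) (abs_nonneg _) ((abs_nonneg _).trans (hC m ω)))
  have hint2 : ∀ N, Integrable (fun ω => (∑ i ∈ Finset.range N, D i ω) ^ 2) μ := by
    intro N
    simp only [sq, Finset.sum_mul_sum]
    exact integrable_finsetSum _ fun i _ => integrable_finsetSum _ fun j _ => hint i j
  induction N with
  | zero => simp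
  | succ N ih =>
    have hcross : Integrable (fun ω => 2 * ∑ i ∈ Finset.range N, D i ω * D N ω) μ :=
      (integrable_finsetSum _ fun i _ => hint i N).const_mul 2
    have e : ∀ ω, (∑ i ∈ Finset.range (N + 1), D i ω) ^ 2
        = ((∑ i ∈ Finset.range N, D i ω) ^ 2 + 2 * ∑ i ∈ Finset.range N, D i ω * D N ω)
          + D N ω * D N ω := by
      intro ω
      rw [Finset.sum_range_succ, ← Finset.sum_mul]; ring
    simp only [e]
    have hA : Integrable (fun ω => (∑ i ∈ Finset.range N, D i ω) ^ 2
        + 2 * ∑ i ∈ Finset.range N, D i ω * D N ω) μ := (hint2 N).add hcross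
    rw [integral_add hA (hint N N), integral_add (hint2 N) hcross,
      integral_const_mul, integral_finsetSum _ fun i _ => hint i N,
      Finset.sum_eq_zero fun i hi => horth i N (Finset.mem_range.1 hi)]
    have : ∫ ω, D N ω * D N ω ∂μ ≤ ∫ _, C ^ 2 ∂μ := by
      refine integral_mono (hint N N) (integrable_const _) fun ω => ?_
      rw [← sq]
      exact sq_le_sq' (abs_le.1 (hC N ω)).1 (abs_le.1 (hC N ω)).2
    simp at this
    push_cast
    linarith

theorem ae_tendsto_sum_div_of_orthogonal [IsProbabilityMeasure μ] {D : ℕ → Ω → ℝ}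
    (hD : ∀ n, Measurable (D n)) {C : ℝ} (hC : ∀ n ω, |D n ω| ≤ C)
    (horth : ∀ m n, m < n → ∫ ω, D m ω * D n ω ∂μ = 0) :
    ∀ᵐ ω ∂μ, Tendsto (fun N : ℕ => (∑ i ∈ Finset.range N, D i ω) / N) atTop (𝓝 0) := by
  set f : ℕ → Ω → ℝ := fun k ω => ((∑ i ∈ Finset.range (k ^ 2), D i ω) / (k ^ 2 : ℝ)) ^ 2 with hf
  have hfm : ∀ k, Measurable (f k) := fun k =>
    ((Finset.measurable_fun_sum _ fun i _ => hD i).div_const _).pow_const 2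
  have hfint : ∀ k, ∫⁻ ω, ENNReal.ofReal (f k ω) ∂μ ≤
      ENNReal.ofReal (C ^ 2 * (1 / (k : ℝ) ^ 2)) := by
    intro k
    have hb : Integrable (f k) μ := by
      refine Integrable.of_bound (hfm k).aestronglyMeasurable
        (((∑ i ∈ Finset.range (k ^ 2), C) / (k ^ 2 : ℝ)) ^ 2) (Eventually.of_forall fun ω => ?_)
      rw [hf, norm_pow, norm_div, Real.norm_eq_abs, Real.norm_eq_abs,
        abs_of_nonneg (by positivity : (0 : ℝ) ≤ (k : ℝ) ^ 2)]
      gcongr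
      exact (Finset.abs_sum_le_sum_abs _ _).trans (Finset.sum_le_sum fun i _ => hC i ω)
    rw [← ofReal_integral_eq_lintegral_ofReal hb (Eventually.of_forall fun ω => sq_nonneg _)]
    refine ENNReal.ofReal_le_ofReal ?_
    simp only [hf, div_pow]
    rw [integral_div]
    have := integral_sum_sq_le hD hC horth (k ^ 2)
    rcases Nat.eq_zero_or_pos k with rfl | hk
    · simp
    · have hkR : (0 : ℝ) < k := by exact_mod_cast hk
      rw [div_le_iff₀ (by positivity)]
      push_cast at this
      refine this.trans_eq ?_
      field_simp
  have hsum : ∑' k, ∫⁻ ω, ENNReal.ofReal (f k ω) ∂μ ≠ ⊤ := by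
    have hs : Summable fun k : ℕ => C ^ 2 * (1 / (k : ℝ) ^ 2) :=
      (Real.summable_one_div_nat_pow.2 (by norm_num)).mul_left _
    refine ne_top_of_le_ne_top ?_ (ENNReal.tsum_le_tsum hfint)
    rw [← ENNReal.ofReal_tsum_of_nonneg (fun k => by positivity) hs]
    exact ENNReal.ofReal_ne_top
  have hfm' : ∀ k, Measurable fun ω => ENNReal.ofReal (f k ω) := fun k => (hfm k).ennreal_ofReal
  rw [← lintegral_tsum fun k => (hfm' k).aemeasurable] at hsum
  filter_upwards [ae_lt_top (Measurable.tsum hfm') hsum] with ω hω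
  refine tendsto_sum_div_of_squares (fun n => hC n ω) ?_
  have h1 := ENNReal.tendsto_atTop_zero_of_tsum_ne_top hω.ne
  have h2 : Tendsto (fun k => f k ω) atTop (𝓝 0) := by
    have h3 := (ENNReal.tendsto_toReal ENNReal.zero_ne_top).comp h1
    refine h3.congr fun k => ?_
    exact ENNReal.toReal_ofReal (sq_nonneg _)
  have h4 := h2.sqrt
  simp only [hf, Real.sqrt_sq_eq_abs, Real.sqrt_zero] at h4
  exact (tendsto_zero_iff_abs_tendsto_zero _).2 h4

/-- A strong law for a recursion `X (n + 1) = F (X n, S n)` driven by i.i.d. variables: the averages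
of `ψ (X n, S n)` vanish if `ψ (X n, ·)` has mean zero, since these variables are then
orthogonal. -/
theorem ae_tendsto_sum_div_of_recursion [IsProbabilityMeasure μ] {E : Type*} [MeasurableSpace E]
    {ν : Measure ℝ} [IsProbabilityMeasure ν] {S : ℕ → Ω → ℝ} (hSm : ∀ n, Measurable (S n))
    (hlaw : ∀ n, μ.map (S n) = ν) (hind : iIndepFun S μ) {F : E × ℝ → E} (hF : Measurable F)
    {X : ℕ → Ω → E} {x₀ : E} (hX0 : ∀ ω, X 0 ω = x₀)
    (hX : ∀ n ω, X (n + 1) ω = F (X n ω, S n ω)) {ψ : E × ℝ → ℝ} (hψ : Measurable ψ) {C : ℝ}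
    (hC : ∀ n ω, |ψ (X n ω, S n ω)| ≤ C) (hmean : ∀ n ω, ∫ s, ψ (X n ω, s) ∂ν = 0) :
    ∀ᵐ ω ∂μ, Tendsto (fun N : ℕ => (∑ i ∈ Finset.range N, ψ (X i ω, S i ω)) / N) atTop (𝓝 0) := by
  -- `G n` is the information available before block `n`
  set G : ℕ → MeasurableSpace Ω := fun n =>
    ⨆ i ∈ Set.Iio n, MeasurableSpace.comap (S i) inferInstance with hG
  have hGmono : ∀ m n, m ≤ n → G m ≤ G n := fun m n hmn =>
    biSup_mono fun i (hi : i < m) => lt_of_lt_of_le hi hmn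
  have hSG : ∀ m n, m < n → Measurable[G n] (S m) := fun m n hmn =>
    Measurable.of_comap_le (le_biSup (fun i => MeasurableSpace.comap (S i) inferInstance)
      (show m ∈ Set.Iio n from hmn))
  have hXG : ∀ n, Measurable[G n] (X n) := by
    intro n
    induction n with
    | zero =>
      rw [funext hX0]; exact @measurable_const _ _ _ (G 0) _
    | succ n ih =>
      rw [funext (hX n)]
      exact hF.comp (Measurable.prodMk (ih.mono (hGmono _ _ n.le_succ) le_rfl)
        (hSG n (n + 1) n.lt_succ_self))
  have hGle : ∀ n, G n ≤ ‹MeasurableSpace Ω› := fun n =>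
    iSup₂_le fun i _ => (hSm i).comap_le
  have hXm : ∀ n, Measurable (X n) := fun n => (hXG n).mono (hGle n) le_rfl
  have hDm : ∀ n, Measurable fun ω => ψ (X n ω, S n ω) := fun n =>
    hψ.comp ((hXm n).prodMk (hSm n))
  refine ae_tendsto_sum_div_of_orthogonal hDm hC fun m n hmn => ?_
  set Z : Ω → ℝ × E := fun ω => (ψ (X m ω, S m ω), X n ω) with hZ
  have hZG : Measurable[G n] Z :=
    (hψ.comp (((hXG m).mono (hGmono m n hmn.le) le_rfl).prodMk (hSG m n hmn))).prodMk (hXG n)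
  have hZm : Measurable Z := hZG.mono (hGle n) le_rfl
  have hindep : IndepFun Z (S n) μ := by
    have h1 := indep_iSup_of_disjoint (fun i => (hSm i).comap_le) hind
      (S := Set.Iio n) (T := {n}) (by simp)
    rw [IndepFun_iff_Indep]
    refine indep_of_indep_of_le_left (indep_of_indep_of_le_right h1 ?_) hZG.comap_le
    exact le_biSup (fun i => MeasurableSpace.comap (S i) inferInstance) (Set.mem_singleton n)
  have hprod : μ.map (fun ω => (Z ω, S n ω)) = (μ.map Z).prod ν := by
    rw [← hlaw n]
    exact (indepFun_iff_map_prod_eq_prod_map_map hZm.aemeasurable (hSm n).aemeasurable).1 hindep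
  have hprodm : Measurable fun ω => (Z ω, S n ω) := hZm.prodMk (hSm n)
  set g : (ℝ × E) × ℝ → ℝ := fun y => y.1.1 * ψ (y.1.2, y.2) with hg
  have hgm : Measurable g := by fun_prop
  have hgi : Integrable g ((μ.map Z).prod ν) := by
    rw [← hprod, integrable_map_measure hgm.aestronglyMeasurable hprodm.aemeasurable]
    refine Integrable.of_bound (hgm.comp hprodm).aestronglyMeasurable (C * C)
      (Eventually.of_forall fun ω => ?_)
    simp only [Function.comp, hg, hZ, norm_mul]
    exact mul_le_mul (hC m ω) (hC n ω) (abs_nonneg _) ((abs_nonneg _).trans (hC m ω))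
  calc ∫ ω, ψ (X m ω, S m ω) * ψ (X n ω, S n ω) ∂μ
      = ∫ y, g y ∂(μ.map fun ω => (Z ω, S n ω)) :=
        (integral_map hprodm.aemeasurable hgm.aestronglyMeasurable).symm
    _ = ∫ z, ∫ s, g (z, s) ∂ν ∂(μ.map Z) := by rw [hprod, integral_prod _ hgi]
    _ = ∫ ω, ∫ s, g (Z ω, s) ∂ν ∂μ :=
        integral_map hZm.aemeasurable hgi.aestronglyMeasurable.integral_prod_right'
    _ = 0 := by
        simp only [hg, hZ, integral_const_mul, hmean, mul_zero, integral_zero]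

end StrongLaw

/-! ### The queue as a measurable recursion on admissible states -/

lemma State.Admissible.arrive {Lp : ℝ} {K : ℕ} (hLp : 0 < Lp) {x : State}
    (hx : x.Admissible Lp K) : (x.arrive Lp K).waiting ≤ K ∧ 0 < (x.arrive Lp K).residual ∧
      (x.arrive Lp K).residual ≤ Lp := by
  obtain ⟨h1, h2, h3, h4⟩ := hx
  unfold State.arrive
  split_ifs with h5 h6
  · exact ⟨h1, hLp, le_rfl⟩
  · exact ⟨h1, lt_of_le_of_ne h2 (Ne.symm h5), h3⟩
  · refine ⟨?_, lt_of_le_of_ne h2 (Ne.symm h5), h3⟩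
    by_contra h7
    exact h6 ⟨h5, Nat.le_of_lt_succ (not_le.1 h7)⟩

lemma admissible_serve {Lp : ℝ} {K : ℕ} (hLp : 0 < Lp) {q : ℕ} (hq : q ≤ K) {r : ℝ}
    (hr : r ≤ Lp) {s : ℝ} (hs : 0 ≤ s) : (serve Lp q r s).Admissible Lp K := by
  induction q generalizing r s with
  | zero =>
    unfold serve
    split_ifs with h
    · exact ⟨hq, (sub_pos.2 h).le, by simp only; linarith, fun _ => rfl⟩
    · exact ⟨hq, le_rfl, hLp.le, fun _ => rfl⟩
  | succ q ih =>
    unfold serve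
    split_ifs with h
    · exact ⟨hq, (sub_pos.2 h).le, by simp only; linarith,
        fun h0 => absurd h0 (sub_pos.2 h).ne'⟩
    · exact ih (by omega) le_rfl (by linarith)

lemma admissible_queue {Lp : ℝ} {K : ℕ} (hLp : 0 < Lp) {x₀ : State} (hx₀ : x₀.Admissible Lp K)
    {s : ℕ → ℝ} (hs : ∀ n, 0 ≤ s n) (n : ℕ) : (queue Lp K x₀ s n).Admissible Lp K := by
  induction n with
  | zero => exact hx₀
  | succ n ih =>
    have h := ih.arrive hLp
    exact admissible_serve hLp h.1 h.2.2 (hs n)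

/-- States carry the measurable structure of `ℕ × ℝ`. -/
instance : MeasurableSpace State :=
  MeasurableSpace.comap (fun x => (x.waiting, x.residual)) inferInstance

lemma measurable_waiting_residual :
    Measurable fun x : State => (x.waiting, x.residual) := comap_measurable _

lemma measurable_waiting : Measurable State.waiting :=
  measurable_fst.comp measurable_waiting_residual

lemma measurable_residual : Measurable State.residual :=
  measurable_snd.comp measurable_waiting_residual

lemma measurable_state_mk {α : Type*} [MeasurableSpace α] {f : α → ℕ} {g : α → ℝ}
    (hf : Measurable f) (hg : Measurable g) : Measurable fun a => State.mk (f a) (g a) :=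
  measurable_comap_iff.2 (hf.prodMk hg)

lemma measurableSet_residual_eq_zero : MeasurableSet {x : State | x.residual = 0} :=
  measurable_residual (measurableSet_singleton 0)

lemma measurableSet_overflow (K : ℕ) : MeasurableSet {x : State | x.Overflow K} :=
  measurableSet_residual_eq_zero.compl.inter (measurable_waiting measurableSet_Ici)

lemma measurable_arrive (Lp : ℝ) (K : ℕ) : Measurable (State.arrive Lp K) := by
  unfold State.arrive
  exact Measurable.ite measurableSet_residual_eq_zero
    (measurable_state_mk measurable_waiting measurable_const)
    (Measurable.ite (measurableSet_overflow K) measurable_id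
      (measurable_state_mk (measurable_waiting.add_const 1) measurable_residual))

lemma measurable_serve (Lp : ℝ) (q : ℕ) :
    Measurable fun y : ℝ × ℝ => serve Lp q y.1 y.2 := by
  have hlt : MeasurableSet {y : ℝ × ℝ | y.2 < y.1} := measurableSet_lt measurable_snd measurable_fst
  have hsub : Measurable fun y : ℝ × ℝ => y.1 - y.2 := by fun_prop
  induction q with
  | zero =>
    simp only [serve]
    exact Measurable.ite hlt (measurable_state_mk measurable_const hsub) measurable_const
  | succ q ih =>
    simp only [serve]
    exact Measurable.ite hlt (measurable_state_mk measurable_const hsub)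
      (ih.comp (measurable_const.prodMk (by fun_prop)))

/-- One step of the queue: an arrival, followed by the service of a block. -/
noncomputable def queueStep (Lp : ℝ) (K : ℕ) (y : State × ℝ) : State :=
  serve Lp (y.1.arrive Lp K).waiting (y.1.arrive Lp K).residual y.2

lemma measurable_queueStep (Lp : ℝ) (K : ℕ) : Measurable (queueStep Lp K) := by
  have h1 : Measurable fun z : ℕ × (ℝ × ℝ) => serve Lp z.1 z.2.1 z.2.2 :=
    measurable_from_prod_countable_right fun q => measurable_serve Lp q
  have h2 : Measurable fun y : State × ℝ => y.1.arrive Lp K :=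
    (measurable_arrive Lp K).comp measurable_fst
  exact h1.comp ((measurable_waiting.comp h2).prodMk
    ((measurable_residual.comp h2).prodMk measurable_snd))

lemma measurable_valueAfter (θ lam : ℝ) (K : ℕ) :
    Measurable fun x : State => valueAfter θ lam K x.waiting x.residual := by
  have h : Measurable fun z : ℕ × ℝ => valueAfter θ lam K z.1 z.2 := by
    refine measurable_from_prod_countable_right fun q => Continuous.measurable ?_
    have := continuous_scaleFun θ (K - q)
    simp only [valueAfter]
    fun_prop
  exact h.comp measurable_waiting_residual

lemma measurable_valueBefore (θ lam : ℝ) (K : ℕ) : Measurable (valueBefore θ lam K) := by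
  have h : Measurable fun z : ℕ × ℝ => (1 - overflowProb θ K) * (1 + lam * z.2) - (K - z.1)
      + valueCoeff θ K * scaleFun θ (K - z.1 - 1) (lam * z.2) := by
    refine measurable_from_prod_countable_right fun q => Continuous.measurable ?_
    have := continuous_scaleFun θ (K - q - 1)
    simp only
    fun_prop
  unfold valueBefore
  exact Measurable.ite measurableSet_residual_eq_zero measurable_const
    (h.comp measurable_waiting_residual)

/-! ### The long-run fraction of rejected packets -/

open Classical in
/-- The case of measurable, nonnegative services. The Poisson equation writes the excess number of
overflows among the first `N` packets as a bounded term minus a sum of bounded orthogonal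
variables. -/
theorem ae_tendsto_overflowFraction {Ω : Type*} [MeasurableSpace Ω] {μ : Measure Ω}
    [IsProbabilityMeasure μ] {θ lam Lp : ℝ} (h1 : θ < 1) (hlam : 0 < lam) (hLp : 0 < Lp)
    (hθ : lam * Lp = θ) {S : ℕ → Ω → ℝ} (hSm : ∀ n, Measurable (S n)) (hS0 : ∀ n ω, 0 ≤ S n ω)
    (hlaw : ∀ n, μ.map (S n) = expMeasure lam) (hind : iIndepFun S μ) {K : ℕ} {x₀ : State}
    (hx₀ : x₀.Admissible Lp K) :
    ∀ᵐ ω ∂μ, Tendsto (fun N : ℕ => overflowFraction Lp K x₀ (fun n => S n ω) N) atTop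
      (𝓝 (overflowProb θ K)) := by
  have h0 : 0 < θ := hθ ▸ mul_pos hlam hLp
  have := isProbabilityMeasure_expMeasure hlam
  set X : ℕ → Ω → State := fun n ω => queue Lp K x₀ (fun n => S n ω) n with hX
  have hadm : ∀ n ω, (X n ω).Admissible Lp K := fun n ω =>
    admissible_queue hLp hx₀ (fun n => hS0 n ω) n
  have hstep : ∀ n ω, X (n + 1) ω = queueStep Lp K (X n ω, S n ω) := fun n ω => rfl
  set V := valueBefore θ lam K with hV
  set H : State → ℝ := fun x => valueAfter θ lam K x.waiting x.residual with hH
  set ψ : State × ℝ → ℝ := fun y => V (queueStep Lp K y) - H (y.1.arrive Lp K) with hψ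
  have hψm : Measurable ψ :=
    ((measurable_valueBefore θ lam K).comp (measurable_queueStep Lp K)).sub
      ((measurable_valueAfter θ lam K).comp ((measurable_arrive Lp K).comp measurable_fst))
  obtain ⟨C, hC⟩ := exists_abs_valueBefore_le θ lam Lp K
  have hmean : ∀ n ω, ∫ s, ψ (X n ω, s) ∂(expMeasure lam) = 0 := fun n ω => by
    have h := (hadm n ω).arrive hLp
    have h2 := ((hasExpMean_valueBefore_serve h0 h1 hlam hLp hθ h.1 h.2.1).sub_const hlam
      (H ((X n ω).arrive Lp K))).integral_expMeasure hlam
    exact h2.trans (sub_self _)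
  have hpois : ∀ n ω, V (X n ω)
      = (if (X n ω).Overflow K then 1 else 0) - overflowProb θ K + H ((X n ω).arrive Lp K) :=
    fun n ω => valueBefore_eq hθ (hadm n ω)
  have hbound : ∀ n ω, |ψ (X n ω, S n ω)| ≤ 2 * C + 1 + |overflowProb θ K| := fun n ω => by
    have h2 : ψ (X n ω, S n ω) = V (X (n + 1) ω) - H ((X n ω).arrive Lp K) := rfl
    have h3 := abs_le.1 (hC _ (hadm (n + 1) ω))
    have h4 := abs_le.1 (hC _ (hadm n ω))
    have h5 := hpois n ω
    have h6 := abs_le.1 (le_refl |overflowProb θ K|)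
    rw [h2, abs_le]
    split_ifs at h5 <;> constructor <;> linarith [h3.1, h3.2, h4.1, h4.2, h6.1, h6.2]
  filter_upwards [ae_tendsto_sum_div_of_recursion hSm hlaw hind (measurable_queueStep Lp K)
    (X := X) (fun _ => rfl) hstep hψm hbound hmean] with ω hω
  have hcount : ∀ N : ℕ,
      (((Finset.range N).filter fun n => (X n ω).Overflow K).card : ℝ)
        = (∑ i ∈ Finset.range N, ψ (X i ω, S i ω)) + N * overflowProb θ K
          - (V (X N ω) - V (X 0 ω)) := by
    intro N
    rw [Finset.card_filter, ← Finset.sum_range_sub (fun n => V (X n ω))]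
    push_cast
    rw [eq_sub_iff_add_eq, ← Finset.sum_add_distrib, ← sub_eq_iff_eq_add, ← nsmul_eq_mul,
      ← Finset.card_range N, ← Finset.sum_const, Finset.card_range, ← Finset.sum_sub_distrib]
    refine Finset.sum_congr rfl fun n _ => ?_
    have h2 : ψ (X n ω, S n ω) = V (X (n + 1) ω) - H ((X n ω).arrive Lp K) := rfl
    rw [h2, hpois n ω]
    ring
  have hV0 : Tendsto (fun N : ℕ => (V (X N ω) - V (X 0 ω)) / (N : ℝ)) atTop (𝓝 0) := by
    refine squeeze_zero_norm (fun N => ?_) (tendsto_const_div_atTop_nhds_zero_nat (2 * C))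
    rw [norm_div, Real.norm_natCast]
    gcongr
    refine (norm_sub_le _ _).trans ?_
    have h3 : ‖V (X N ω)‖ ≤ C := hC _ (hadm N ω)
    have h4 : ‖V (X 0 ω)‖ ≤ C := hC _ (hadm 0 ω)
    linarith
  have hlim := (hω.add_const (overflowProb θ K)).sub hV0
  rw [zero_add, sub_zero] at hlim
  refine hlim.congr' ?_
  filter_upwards [eventually_ge_atTop 1] with N hN
  have hN' : (N : ℝ) ≠ 0 := by positivity
  change _ = (((Finset.range N).filter fun n => (X n ω).Overflow K).card : ℝ) / N
  rw [hcount]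
  field_simp

lemma ae_nonneg_of_hasLaw_expMeasure {Ω : Type*} [MeasurableSpace Ω] {μ : Measure Ω} {lam : ℝ}
    {f : Ω → ℝ} (hf : HasLaw f (expMeasure lam) μ) : ∀ᵐ ω ∂μ, 0 ≤ f ω := by
  have h : ∀ᵐ x ∂(μ.map f), 0 ≤ x := by
    rw [hf.map_eq, ae_iff]
    change (volume.withDensity (exponentialPDF lam)) {x | ¬ 0 ≤ x} = 0
    have e : {x : ℝ | ¬ 0 ≤ x} = Set.Iio 0 := by ext x; simp
    rw [e, withDensity_apply _ measurableSet_Iio]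
    exact lintegral_exponentialPDF_of_nonpos le_rfl
  exact ae_of_ae_map hf.aemeasurable h

end FadingQueue

/-- Overflow probability of a buffer of size `K` over a block Rayleigh fading channel in the low SNR
regime: the services `s n` of the blocks are i.i.d. exponential with mean `W * TB * ρ`. -/
theorem mainTheorem1
    {Ω : Type*} [MeasurableSpace Ω] (μ : Measure Ω) [IsProbabilityMeasure μ]
    (W TB ρ Lp θ : ℝ) (hW : 0 < W) (hTB : 0 < TB) (hρ : 0 < ρ) (hLp : 0 < Lp)
    (hθ : θ = Lp / (W * TB * ρ)) (hθ1 : θ < 1)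
    (s : ℕ → Ω → ℝ)
    (hs_law : ∀ n, HasLaw (s n) (expMeasure (1 / (W * TB * ρ))) μ)
    (hs_indep : iIndepFun s μ)
    (K : ℕ) (x₀ : FadingQueue.State) (hx₀ : x₀.Admissible Lp K) :
    Summable (fun i : ℕ => FadingQueue.phiTerm θ K (i + 1)) ∧
    ∀ᵐ ω ∂μ, Tendsto
      (fun N : ℕ => FadingQueue.overflowFraction Lp K x₀ (fun n => s n ω) N) atTop
      (𝓝 ((1 - θ) * FadingQueue.phi θ K / (1 - θ * FadingQueue.phi θ K))) := by
  have hlam : 0 < 1 / (W * TB * ρ) := by positivity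
  have hθ' : 1 / (W * TB * ρ) * Lp = θ := by rw [hθ]; ring
  refine ⟨FadingQueue.summable_phiTerm (hθ' ▸ mul_pos hlam hLp) hθ1 K, ?_⟩
  -- measurable, nonnegative versions of the services
  set S : ℕ → Ω → ℝ := fun n ω => max ((hs_law n).aemeasurable.mk (s n) ω) 0 with hS
  have hSs : ∀ n, s n =ᵐ[μ] S n := fun n => by
    filter_upwards [(hs_law n).aemeasurable.ae_eq_mk,
      FadingQueue.ae_nonneg_of_hasLaw_expMeasure (hs_law n)] with ω h1 h2
    rw [hS]
    simp only
    rw [← h1, max_eq_left h2]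
  have hlim := FadingQueue.ae_tendsto_overflowFraction hθ1 hlam hLp hθ' (S := S)
    (fun n => (hs_law n).aemeasurable.measurable_mk.max measurable_const)
    (fun n ω => le_max_right _ _)
    (fun n => by rw [← Measure.map_congr (hSs n), (hs_law n).map_eq])
    (hs_indep.congr hSs) hx₀
  filter_upwards [hlim, ae_all_iff.2 hSs] with ω h1 h2
  rw [funext h2]
  exact h1
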